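/- Let $C$ be a field of characteristic $0$ and let $$S := C\big[s,t,\tfrac{1}{3s^2-1}\big]/(s^3-s-t^2).$$ Let $I=(s,t)\subseteq S$, and let $M$ be the $S$-module with generators $f_1,f_2$ and relations $tf_1-sf_2=0$, $(s^2-1)f_1-tf_2=0$. An iterative derivation on a commutative ring $R$ is a family of additive maps $\theta^{(n)}:R\to R$ $(n\ge 0)$ with $\theta^{(0)}=\mathrm{id}$, $\theta^{(n)}(xy)=\sum_{i+j=n}\theta^{(i)}(x)\theta^{(j)}(y)$ and $\theta^{(i)}\circ\theta^{(j)}=\binom{i+j}{i}\theta^{(i+j)}$. An iterative derivation on an $R$-module $N$ over $(R,\theta)$ is a family of additive maps $\theta_N^{(n)}:N\to N$ with $\theta_N^{(0)}=\mathrm{id}$, $\theta_N^{(n)}(xm)=\sum_{i+j=n}\theta^{(i)}(x)\theta_N^{(j)}(m)$ for $x\in R$, $m\in N$, and $\theta_N^{(i)}\circ\theta_N^{(j)}=\binom{i+j}{i}\theta_N^{(i+j)}$; a finitely generated $R$-module with such a family is an ID-module. The ring $(R,\theta)$ is ID-simple if $R\neq 0$ and the only ideals of $R$ stable under all $\theta^{(n)}$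 are $0$ and $R$. Then: 1. $S$ is a Dedekind domain, and there is an isomorphism of $S$-modules $M\to I$ with $f_1\mapsto s$, $f_2\mapsto t$. 2. The ideal $I$ is not principal, and both $I$ and $M$ are finitely generated projective $S$-modules of constant rank $1$ that are not free. 3. There is exactly one iterative derivation $\theta$ on $S$ that extends the iterative derivation on $C[t]$ given by $f(t)\mapsto f(t+T)=\sum_n\theta^{(n)}(f)T^n$, and $(S,\theta)$ is ID-simple. For every $b\in S$ there is exactly one iterative derivation $\theta_M$ on $M$ over $(S,\theta)$ with $$\theta_M^{(1)}(f_1)=bf_1+\tfrac{3s^2+1}{3s^2-1}f_2,\qquad \theta_M^{(1)}(f_2)=sf_1+bf_2.$$ In particular, for every $b\in S$, $(M,\theta_M)$ is an ID-module over the ID-simple ring $(S,\theta)$ that is not free as an $S$-module. -/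

import Mathlib

namespace NonFreeID

/-- An iterative derivation on a commutative ring `R`: additive maps `θ⁽ⁿ⁾ : R → R` with
`θ⁽⁰⁾ = id`, the Leibniz rule and the iteration rule. -/
@[ext]
structure IterativeDerivation (R : Type*) [CommRing R] where
  θ : ℕ → R →+ R
  zero' : ∀ r, θ 0 r = r
  leibniz' : ∀ n r s, θ n (r * s) = ∑ ij ∈ Finset.HasAntidiagonal.antidiagonal n, θ ij.1 r * θ ij.2 s
  iterate' : ∀ i j r, θ i (θ j r) = ((i + j).choose i) • θ (i + j) r

/-- An iterative derivation on a module `M` over the ID-ring `(R, D)`.  An ID-module is a finitely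
generated `R`-module together with such a structure. -/
@[ext]
structure ModuleIterativeDerivation {R : Type*} [CommRing R] (D : IterativeDerivation R)
    (M : Type*) [AddCommGroup M] [Module R M] where
  θ : ℕ → M →+ M
  zero' : ∀ m, θ 0 m = m
  leibniz' : ∀ n (r : R) (m : M),
    θ n (r • m) = ∑ ij ∈ Finset.HasAntidiagonal.antidiagonal n, D.θ ij.1 r • θ ij.2 m
  iterate' : ∀ i j m, θ i (θ j m) = ((i + j).choose i) • θ (i + j) m

/-- `(R, D)` is ID-simple: `R ≠ 0`, and `0` and `R` are the only ideals stable under all `θ⁽ⁿ⁾`. -/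
def IsIDSimple {R : Type*} [CommRing R] (D : IterativeDerivation R) : Prop :=
  Nontrivial R ∧
    ∀ J : Ideal R, (∀ n, ∀ x ∈ J, D.θ n x ∈ J) → J = ⊥ ∨ J = ⊤

/-- The iterative derivation with respect to `t` on `C[t]`, i.e. the coefficients of
`f(t) ↦ f(t + T)`; these are the Hasse derivatives. -/
noncomputable def polyID (C : Type*) [Field C] : IterativeDerivation (Polynomial C) where
  θ n := (Polynomial.hasseDeriv n).toAddMonoidHom
  zero' r := by simp
  leibniz' n r s := Polynomial.hasseDeriv_mul n r s
  iterate' i j r := by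
    have h := LinearMap.congr_fun (Polynomial.hasseDeriv_comp (R := C) i j) r
    simpa using h

/-- `f(t + T) = ∑ θ⁽ⁿ⁾(f) Tⁿ`, as a check on `polyID` (`Polynomial.taylor` with `C[t]` coefficients,
evaluated at the generic point `t`). -/
theorem polyID_expansion (C : Type*) [Field C] (f : Polynomial C) (n : ℕ) :
    (Polynomial.taylor (Polynomial.X : Polynomial C) (f.map Polynomial.C)).coeff n
      = (polyID C).θ n f := by
  rw [Polynomial.taylor_coeff]
  have h : Polynomial.hasseDeriv n (f.map Polynomial.C)
      = (Polynomial.hasseDeriv n f).map (Polynomial.C : C →+* Polynomial C) := by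
    ext1 k
    simp [Polynomial.hasseDeriv_coeff]
  rw [h, Polynomial.eval_map]
  exact Polynomial.eval₂_C_X

section Ring

variable (C : Type*) [Field C]

/-- The polynomial ring `C[s,t]`; `s` is the variable `0` and `t` the variable `1`. -/
abbrev Poly := MvPolynomial (Fin 2) C

/-- The polynomial `3 s² - 1`. -/
noncomputable def delta : Poly C := 3 * MvPolynomial.X 0 ^ 2 - 1

/-- The ring `C[s, t, 1/(3 s² - 1)]`. -/
abbrev PolyLoc := Localization.Away (delta C)

/-- The element `s³ - s - t²` of `C[s, t, 1/(3 s² - 1)]`. -/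
noncomputable def curveEq : PolyLoc C :=
  algebraMap (Poly C) (PolyLoc C)
    (MvPolynomial.X 0 ^ 3 - MvPolynomial.X 0 - MvPolynomial.X 1 ^ 2)

/-- The ring `S = C[s, t, 1/(3 s² - 1)] / (s³ - s - t²)`. -/
abbrev S := PolyLoc C ⧸ Ideal.span {curveEq C}

/-- The class of `s` in `S`. -/
noncomputable def s : S C :=
  Ideal.Quotient.mk _ (algebraMap (Poly C) (PolyLoc C) (MvPolynomial.X 0))

/-- The class of `t` in `S`. -/
noncomputable def t : S C :=
  Ideal.Quotient.mk _ (algebraMap (Poly C) (PolyLoc C) (MvPolynomial.X 1))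

/-- The class of `1/(3 s² - 1)` in `S`. -/
noncomputable def dinv : S C :=
  Ideal.Quotient.mk _ (IsLocalization.Away.invSelf (S := PolyLoc C) (delta C))

theorem dinv_spec : (3 * s C ^ 2 - 1) * dinv C = 1 := by
  have h := congrArg (Ideal.Quotient.mk (Ideal.span {curveEq C}))
    (IsLocalization.Away.mul_invSelf (S := PolyLoc C) (delta C))
  simp only [delta, map_mul, map_sub, map_pow, map_ofNat, map_one] at h
  exact h

theorem curve_spec : s C ^ 3 - s C = t C ^ 2 := by
  have h : Ideal.Quotient.mk (Ideal.span {curveEq C}) (curveEq C) = 0 :=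
    Ideal.Quotient.eq_zero_iff_mem.mpr (Ideal.subset_span rfl)
  have h' : s C ^ 3 - s C - t C ^ 2 = 0 := by
    have h2 : Ideal.Quotient.mk (Ideal.span {curveEq C}) (algebraMap (Poly C) (PolyLoc C)
      (MvPolynomial.X 0 ^ 3 - MvPolynomial.X 0 - MvPolynomial.X 1 ^ 2)) = 0 := h
    simp only [map_sub, map_pow] at h2
    exact h2
  exact sub_eq_zero.mp h'

/-- The canonical homomorphism `C[t] → S`. -/
noncomputable def ofPoly : Polynomial C →+* S C :=
  (Polynomial.aeval (R := C) (t C)).toRingHom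

/-- `D` is an iterative derivation on `S` extending the one by `t` on `C[t]`. -/
def ExtendsPolyID (D : IterativeDerivation (S C)) : Prop :=
  ∀ (n : ℕ) (f : Polynomial C), D.θ n (ofPoly C f) = ofPoly C ((polyID C).θ n f)

/-- The ideal `I = (s, t)` of `S`. -/
noncomputable def I : Ideal (S C) := Ideal.span {s C, t C}

/-- The submodule of `S²` spanned by the relations `(t, -s)` and `(s² - 1, -t)`. -/
noncomputable def relations : Submodule (S C) (Fin 2 → S C) :=
  Submodule.span (S C) {![t C, -s C], ![s C ^ 2 - 1, -t C]}

/-- The `S`-module `M` with generators `f₁`, `f₂` and relations `t f₁ - s f₂ = 0`,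
`(s² - 1) f₁ - t f₂ = 0`. -/
abbrev M := (Fin 2 → S C) ⧸ relations C

/-- The generator `f₁` of `M`. -/
noncomputable def f₁ : M C := (relations C).mkQ (Pi.single 0 1)

/-- The generator `f₂` of `M`. -/
noncomputable def f₂ : M C := (relations C).mkQ (Pi.single 1 1)

end Ring

/-- `N` is a finitely generated projective `R`-module of constant rank `1` that is not free. -/
def IsNonFreeProjectiveOfRankOne (R : Type*) [CommRing R] (N : Type*) [AddCommGroup N]
    [Module R N] : Prop :=
  Module.Finite R N ∧ Module.Projective R N ∧
    (∀ p : PrimeSpectrum R, Module.rankAtStalk (R := R) N p = 1) ∧ ¬ Module.Free R N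

end NonFreeID

namespace NonFreeID

open Polynomial WeierstrassCurve.Affine

/-! `S` is the coordinate ring of the elliptic curve y² = x³ - x with 3x² - 1 inverted. The
coordinate ring is integrally closed because x³ - x is squarefree and 2 is invertible, so it and its
localization `S` are Dedekind. Nonzero ideals are then invertible, hence projective of rank 1, and M
≅ I because the two relations generate all syzygies of (s, t).

The heart is that `I` is not principal (`not_isPrincipal_I`). Since I² = (s), a generator would give
an element of the coordinate ring with norm x·w, where w divides a power of 3x² - 1. Such an element
does not exist (`CurveRing.norm_ne_X_mul`): at a valuation ring of residue characteristic 3 the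
polynomial 3x² - 1 reduces to -1, so after scaling the reduced element has a norm of degree 1, and
no norm from a Weierstrass coordinate ring has degree 1.

In characteristic 0 an iterative derivation is the same as its first map d, through dⁿ/n!. As 3s² -
1 is a unit, d/dt has exactly one extension to `S`. A nonzero stable ideal meets C[t], and there
enough Hasse derivatives produce a nonzero constant. On `M` only the compatibility of the prescribed
values with the two relations has to be checked. -/

/-- The affine Weierstrass curve `y² = x³ - x`. -/
def curve (k : Type*) [CommRing k] : WeierstrassCurve.Affine k := ⟨0, 0, 0, -1, 0⟩

/-- The affine coordinate ring `k[x, y] / (y² - x³ + x)`. -/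
abbrev CurveRing (k : Type*) [CommRing k] := (curve k).CoordinateRing

section Coefficients

variable (k : Type*) [CommRing k]

@[simp] theorem curve_a₁ : (curve k).a₁ = 0 := rfl
@[simp] theorem curve_a₂ : (curve k).a₂ = 0 := rfl
@[simp] theorem curve_a₃ : (curve k).a₃ = 0 := rfl
@[simp] theorem curve_a₄ : (curve k).a₄ = -1 := rfl
@[simp] theorem curve_a₆ : (curve k).a₆ = 0 := rfl

end Coefficients

/-! ### The coordinate ring of y² = x³ - x is a Dedekind domain. -/

namespace CurveRing

section Basic

variable {k : Type*} [CommRing k]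

theorem norm_eq (p q : k[X]) :
    Algebra.norm k[X] (p • (1 : CurveRing k) + q • CoordinateRing.mk (curve k) X) =
      p ^ 2 - q ^ 2 * (X ^ 3 - X) := by
  rw [CoordinateRing.norm_smul_basis]
  simp only [curve_a₁, curve_a₂, curve_a₃, curve_a₄, curve_a₆, C_0, C_neg, C_1]
  ring

theorem y_sq : CoordinateRing.mk (curve k) X ^ 2 = algebraMap k[X] (CurveRing k) (X ^ 3 - X) := by
  refine AdjoinRoot.mk_eq_mk.mpr ⟨1, ?_⟩
  simp only [WeierstrassCurve.Affine.polynomial, curve_a₁, curve_a₂, curve_a₃, curve_a₄, curve_a₆,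
    C_0, C_neg, C_1, C_sub, C_pow, C_add, C_mul, algebraMap_eq]
  ring

theorem exists_eq (a : CurveRing k) : ∃ p q : k[X],
    a = algebraMap k[X] _ p + algebraMap k[X] _ q * CoordinateRing.mk (curve k) X := by
  obtain ⟨p, q, h⟩ := CoordinateRing.exists_smul_basis_eq a
  exact ⟨p, q, by rw [← h, Algebra.smul_def, Algebra.smul_def, mul_one]⟩

instance : Module.Finite k[X] (CurveRing k) := .of_basis (CoordinateRing.basis (curve k))

/-- The involution `y ↦ -y`. -/
noncomputable def conj : CurveRing k →ₐ[k[X]] CurveRing k :=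
  AdjoinRoot.liftAlgHom _ (Algebra.ofId _ _) (-CoordinateRing.mk (curve k) X) <| by
    have h := y_sq (k := k)
    simp only [WeierstrassCurve.Affine.polynomial, eval₂_sub, eval₂_pow,
      eval₂_X, eval₂_C, neg_sq, curve_a₁, curve_a₂, curve_a₃, curve_a₄, curve_a₆,
      C_neg, C_1, zero_mul, map_zero, add_zero]
    erw [h]
    simp only [RingHom.coe_coe, Algebra.ofId_apply, ← map_sub]
    rw [show (X : k[X]) ^ 3 - X - (X ^ 3 + -1 * X) = 0 by ring, map_zero]

theorem conj_y : conj (CoordinateRing.mk (curve k) X) = -CoordinateRing.mk (curve k) X := by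
  simp [conj, CoordinateRing.mk]

end Basic

section Dedekind

variable {k : Type*} [Field k] [CharZero k]

theorem squarefree_X_pow_three_sub_X : Squarefree (X ^ 3 - X : k[X]) := by
  refine Separable.squarefree ?_
  -- Bézout coefficients for f = X³ - X and f' = 3X² - 1.
  refine ⟨-(C (9 / 2) * X), C (3 / 2) * X ^ 2 - 1, ?_⟩
  have h2 : (C (1 / 2) : k[X]) * 2 = 1 := by
    rw [← map_ofNat C 2, ← C_mul]; norm_num
  have h3 : (C (3 / 2) : k[X]) = 3 * C (1 / 2) := by
    rw [← map_ofNat C 3, ← C_mul]; norm_num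
  have h9 : (C (9 / 2) : k[X]) = 9 * C (1 / 2) := by
    rw [← map_ofNat C 9, ← C_mul]; norm_num
  rw [h3, h9]
  simp only [derivative_sub, derivative_X_pow, derivative_X, Nat.cast_ofNat, map_ofNat]
  linear_combination (3 * X ^ 2) * h2

/-- After division by the gcd, d' is coprime to q', so d'² divides the squarefree f and d' is a
unit. -/
theorem dvd_of_sq_dvd_sq_mul {R : Type*} [CommRing R] [IsDomain R] [UniqueFactorizationMonoid R]
    {d q f : R} (hf : Squarefree f) (h : d ^ 2 ∣ q ^ 2 * f) : d ∣ q := by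
  by_cases hd : d = 0
  · subst hd
    have : q ^ 2 * f = 0 := by simpa using h
    rcases mul_eq_zero.mp this with h | h
    · simp [pow_eq_zero_iff] at h; simp [h]
    · exact absurd h hf.ne_zero
  classical
  let := UniqueFactorizationMonoid.toGCDMonoid R
  obtain ⟨q', hq⟩ := gcd_dvd_left q d
  obtain ⟨d', hd'⟩ := gcd_dvd_right q d
  set g := gcd q d
  have hg : g ≠ 0 := fun h => hd (by rw [hd', h, zero_mul])
  have hcop : IsUnit (gcd q' d') := isUnit_gcd_of_eq_mul_gcd hq hd' hg
  have h' : d' ^ 2 ∣ q' ^ 2 * f := by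
    refine (mul_dvd_mul_iff_left (pow_ne_zero 2 hg)).mp ?_
    rw [← mul_pow, ← hd', ← mul_assoc, ← mul_pow, ← hq]; exact h
  have hrel : IsRelPrime (d' ^ 2) (q' ^ 2) :=
    (gcd_isUnit_iff_isRelPrime.mp hcop).symm.pow
  have := hf d' (by rw [← sq]; exact hrel.dvd_of_dvd_mul_left h')
  rw [hd', hq]
  exact mul_dvd_mul_left _ this.dvd

/-- A quotient of elements of `R` that is integral over `R` is in `R`. -/
theorem dvd_of_isIntegral {R K : Type*} [CommRing R] [IsDomain R] [IsIntegrallyClosed R]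
    [Field K] [Algebra R K] [FaithfulSMul R K] {a d : R} (hd : d ≠ 0) {x : K}
    (hx : x * algebraMap R K d = algebraMap R K a) (h : IsIntegral R x) : d ∣ a := by
  have hinj := FaithfulSMul.algebraMap_injective R K
  let F := FractionRing R
  let i : F →ₐ[R] K := IsFractionRing.liftAlgHom (K := F) (g := Algebra.ofId R K) hinj
  have hd' : algebraMap R F d ≠ 0 := by simpa using hd
  have hdK : algebraMap R K d ≠ 0 := fun h => hd (hinj (by rw [h, map_zero]))
  have hi : i (algebraMap R F a / algebraMap R F d) = x := by
    rw [map_div₀, i.commutes, i.commutes, ← hx, mul_div_assoc, div_self hdK, mul_one]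
  rw [← hi, isIntegral_algHom_iff i i.toRingHom.injective] at h
  obtain ⟨c, hc⟩ := IsIntegrallyClosed.isIntegral_iff.mp h
  refine ⟨c, IsFractionRing.injective R F ?_⟩
  rw [map_mul, hc, mul_div_cancel₀ _ hd']

-- The conjugate p - qy is such a multiplier, with d the norm. Hence every fraction has a
-- representation with denominator in k[x].
omit [CharZero k] in
theorem exists_mul_eq_algebraMap {a : CurveRing k} (ha : a ≠ 0) :
    ∃ b : CurveRing k, ∃ d : k[X], d ≠ 0 ∧ a * b = algebraMap k[X] _ d := by
  obtain ⟨p, q, rfl⟩ := exists_eq a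
  refine ⟨algebraMap k[X] _ p - algebraMap k[X] _ q * CoordinateRing.mk (curve k) X,
    p ^ 2 - q ^ 2 * (X ^ 3 - X), ?_, ?_⟩
  · intro h
    rw [← norm_eq, Algebra.norm_eq_zero_iff, Algebra.smul_def, Algebra.smul_def, mul_one] at h
    exact ha h
  · rw [map_sub, map_mul, map_pow, map_pow, ← y_sq]
    ring

/-- Write an integral fraction as z = (p + qy)/d with conjugate σz. Then z + σz = 2p/d and (z - σz)²
= (2q)²(x³ - x)/d² are integral over k[x], so they lie in k[x]. As 2 is a unit and x³ - x is
squarefree, d divides both p and q. -/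
instance isIntegrallyClosed : IsIntegrallyClosed (CurveRing k) := by
  let K := FractionRing (CurveRing k)
  refine (isIntegrallyClosed_iff K).mpr fun {x} hx => ?_
  obtain ⟨a, b, hb, rfl⟩ := IsFractionRing.div_surjective (A := CurveRing k) x
  have hb0 := nonZeroDivisors.ne_zero hb
  obtain ⟨c, d, hd, hbc⟩ := exists_mul_eq_algebraMap hb0
  obtain ⟨p, q, hpq⟩ := exists_eq (a * c)
  set y := CoordinateRing.mk (curve k) X
  set ι := algebraMap (CurveRing k) K
  have hι : Function.Injective ι := IsFractionRing.injective _ _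
  have hιd : ι (algebraMap k[X] _ d) ≠ 0 :=
    (map_ne_zero_iff ι hι).mpr
      ((map_ne_zero_iff _ (FaithfulSMul.algebraMap_injective k[X] (CurveRing k))).mpr hd)
  have hιb : ι b ≠ 0 := (map_ne_zero_iff ι hι).mpr hb0
  have hxd : ι a / ι b * ι (algebraMap k[X] _ d) =
      ι (algebraMap k[X] _ p + algebraMap k[X] _ q * y) := by
    rw [← hpq, ← hbc, map_mul, map_mul, div_mul_eq_mul_div, div_eq_iff hιb]
    ring
  set z := ι a / ι b
  have hzint : IsIntegral k[X] z := isIntegral_trans z hx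
  -- the conjugate of `z`
  have hconj : ∀ u : CurveRing k, u ≠ 0 → conj u ≠ 0 := by
    intro u hu h
    obtain ⟨v, e, he, huv⟩ := exists_mul_eq_algebraMap hu
    have := congrArg conj huv
    rw [map_mul, h, zero_mul, AlgHom.commutes] at this
    exact he (FaithfulSMul.algebraMap_injective k[X] (CurveRing k) (by rw [← this, map_zero]))
  have hg : Function.Injective
      (((Algebra.ofId (CurveRing k) K).restrictScalars k[X]).comp conj) :=
    hι.comp ((injective_iff_map_eq_zero conj).mpr fun u hu => by_contra fun h => hconj u h hu)
  obtain ⟨σ, hσ⟩ : ∃ σ : K →ₐ[k[X]] K, ∀ u, σ (ι u) = ι (conj u) :=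
    ⟨IsFractionRing.liftAlgHom hg, fun u => IsFractionRing.lift_algebraMap hg u⟩
  have hzc : σ z * ι (algebraMap k[X] _ d) = ι (algebraMap k[X] _ p - algebraMap k[X] _ q * y) := by
    have h := congrArg σ hxd
    rw [map_mul, hσ, hσ, map_add, map_mul, AlgHom.commutes, AlgHom.commutes, AlgHom.commutes,
      conj_y] at h
    rw [h]; congr 1; ring
  have hcint : IsIntegral k[X] (σ z) := hzint.map σ
  have hp : d ∣ 2 * p := by
    refine dvd_of_isIntegral (K := K) hd (x := z + σ z) ?_ (hzint.add hcint)
    rw [IsScalarTower.algebraMap_apply k[X] (CurveRing k) K,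
      IsScalarTower.algebraMap_apply k[X] (CurveRing k) K, add_mul, hxd, hzc, ← map_add]
    congr 1
    rw [map_mul, map_ofNat]; ring
  have hq : d ^ 2 ∣ (2 * q) ^ 2 * (X ^ 3 - X) := by
    refine dvd_of_isIntegral (K := K) (pow_ne_zero 2 hd) (x := (z - σ z) ^ 2) ?_
      ((hzint.sub hcint).pow 2)
    rw [IsScalarTower.algebraMap_apply k[X] (CurveRing k) K,
      IsScalarTower.algebraMap_apply k[X] (CurveRing k) K, map_pow, map_pow, ← mul_pow, sub_mul,
      hxd, hzc, ← map_sub, ← map_pow, map_mul, ← y_sq]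
    congr 1
    rw [map_pow, map_mul, map_ofNat]; ring
  have h2 : IsUnit (2 : k[X]) := by
    rw [← map_ofNat C 2]; exact isUnit_C.mpr (by simp)
  obtain ⟨p', rfl⟩ := h2.dvd_mul_left.mp hp
  obtain ⟨q', rfl⟩ := h2.dvd_mul_left.mp (dvd_of_sq_dvd_sq_mul squarefree_X_pow_three_sub_X hq)
  refine ⟨algebraMap k[X] _ p' + algebraMap k[X] _ q' * y, ?_⟩
  refine mul_right_cancel₀ hιd ?_
  rw [hxd, ← map_mul]
  congr 1
  rw [map_mul, map_mul]; ring

instance isDedekindDomain : IsDedekindDomain (CurveRing k) where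
  toIsDomain := inferInstance
  toIsNoetherian := isNoetherianRing_iff.mp (IsNoetherianRing.of_finite k[X] _)
  toDimensionLEOne := .of_isIntegral k[X] _
  toIsIntegralClosure := (isIntegrallyClosed_iff_isIntegralClosure _).mp inferInstance

end Dedekind
end CurveRing

/-! ### `S` as the localization of the coordinate ring at 3x² - 1. -/

section Presentation

variable (C : Type*) [Field C]

/-- The element `3 x² - 1` of the affine coordinate ring. -/
noncomputable def curveDelta : CurveRing C := algebraMap C[X] _ (3 * X ^ 2 - 1)

/-- The canonical map from the affine coordinate ring to `S`. -/
noncomputable def ofCurve : CurveRing C →+* S C :=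
  AdjoinRoot.lift (Polynomial.aeval (R := C) (s C)).toRingHom (t C) <| by
    have h := curve_spec C
    simp only [WeierstrassCurve.Affine.polynomial, curve_a₁, curve_a₂, curve_a₃, curve_a₄, curve_a₆]
    simp only [eval₂_sub, eval₂_add, eval₂_pow, eval₂_mul, eval₂_X, eval₂_C,
      eval₂_zero, eval₂_neg, eval₂_one, map_zero, map_add,
      map_pow, map_mul, map_neg, map_one, AlgHom.toRingHom_eq_coe, RingHom.coe_coe, aeval_X]
    linear_combination -h

theorem ofCurve_y : ofCurve C (CoordinateRing.mk (curve C) X) = t C := by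
  simp [ofCurve, CoordinateRing.mk]

theorem ofCurve_algebraMap (p : C[X]) :
    ofCurve C (algebraMap C[X] _ p) = Polynomial.aeval (s C) p := by
  simp [ofCurve]

theorem ofCurve_delta : ofCurve C (curveDelta C) = 3 * s C ^ 2 - 1 := by
  rw [curveDelta, ofCurve_algebraMap, map_sub, map_mul, map_ofNat, map_pow, map_one, aeval_X]

theorem isUnit_delta : IsUnit (3 * s C ^ 2 - 1) := .of_mul_eq_one _ (dinv_spec C)

/-- The map `C[s, t] → C[x, y] / (y² - x³ + x)`. -/
noncomputable def polyToCurve : Poly C →ₐ[C] CurveRing C :=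
  MvPolynomial.aeval ![algebraMap C[X] _ X, CoordinateRing.mk (curve C) X]

theorem polyToCurve_delta : polyToCurve C (delta C) = curveDelta C := by
  simp only [polyToCurve, delta, curveDelta, map_sub, map_mul, map_pow, map_one, map_ofNat,
    MvPolynomial.aeval_X, Matrix.cons_val_zero]

theorem polyToCurve_curve : polyToCurve C
    (MvPolynomial.X 0 ^ 3 - MvPolynomial.X 0 - MvPolynomial.X 1 ^ 2) = 0 := by
  have h := CurveRing.y_sq (k := C)
  rw [map_sub, map_sub, map_pow, map_pow]
  simp only [polyToCurve, MvPolynomial.aeval_X, Matrix.cons_val_zero, Matrix.cons_val_one]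
  rw [h, map_sub, map_pow, sub_self]

theorem ofCurve_polyToCurve (p : Poly C) :
    ofCurve C (polyToCurve C p) = Ideal.Quotient.mk _ (algebraMap (Poly C) (PolyLoc C) p) := by
  have : (ofCurve C).comp (polyToCurve C).toRingHom =
      (Ideal.Quotient.mk (Ideal.span {curveEq C})).comp (algebraMap (Poly C) (PolyLoc C)) := by
    refine MvPolynomial.ringHom_ext (fun i => ?_) fun i => ?_
    · have h := ofCurve_algebraMap C (Polynomial.C i)
      rw [aeval_C] at h
      simp only [RingHom.comp_apply, AlgHom.toRingHom_eq_coe, RingHom.coe_coe,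
        ← MvPolynomial.algebraMap_eq, AlgHom.commutes]
      exact h
    · fin_cases i
      · have h := ofCurve_algebraMap C X
        rw [aeval_X] at h
        rw [RingHom.comp_apply, AlgHom.toRingHom_eq_coe, RingHom.coe_coe, polyToCurve,
          MvPolynomial.aeval_X]
        exact h
      · have h := ofCurve_y C
        rw [RingHom.comp_apply, AlgHom.toRingHom_eq_coe, RingHom.coe_coe, polyToCurve,
          MvPolynomial.aeval_X]
        exact h
  exact congrArg (fun f => f p) this

theorem curveDelta_ne_zero [CharZero C] : curveDelta C ≠ 0 := by
  refine (map_ne_zero_iff _ (FaithfulSMul.algebraMap_injective C[X] (CurveRing C))).mpr ?_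
  intro h
  have := congrArg (Polynomial.eval 0) h
  simp at this

/-- The map from `S` to the localization of the affine coordinate ring. -/
noncomputable def toCurveLoc : S C →+* Localization.Away (curveDelta C) :=
  Ideal.Quotient.lift _
    (IsLocalization.Away.lift (delta C)
      (g := (algebraMap (CurveRing C) (Localization.Away (curveDelta C))).comp
        (polyToCurve C).toRingHom)
      (by
        simpa [polyToCurve_delta] using
          IsLocalization.Away.algebraMap_isUnit (S := Localization.Away (curveDelta C))
            (curveDelta C)))
    (by
      intro a ha
      obtain ⟨b, rfl⟩ := Ideal.mem_span_singleton'.mp ha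
      rw [map_mul, curveEq, IsLocalization.Away.lift_eq]
      have h := polyToCurve_curve C
      simp only [RingHom.comp_apply, AlgHom.toRingHom_eq_coe, RingHom.coe_coe, h, map_zero,
        mul_zero])

theorem toCurveLoc_mk (p : Poly C) :
    toCurveLoc C (Ideal.Quotient.mk _ (algebraMap (Poly C) (PolyLoc C) p)) =
      algebraMap _ _ (polyToCurve C p) := by
  rw [toCurveLoc, Ideal.Quotient.lift_mk, IsLocalization.Away.lift_eq]
  rfl

theorem polyToCurve_surjective : Function.Surjective (polyToCurve C) := by
  intro a
  obtain ⟨p, q, rfl⟩ := CurveRing.exists_eq a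
  have h (p : C[X]) : polyToCurve C (Polynomial.aeval (MvPolynomial.X 0) p) =
      algebraMap C[X] _ p := by
    rw [← Polynomial.aeval_algHom_apply]
    simp only [polyToCurve, MvPolynomial.aeval_X, Matrix.cons_val_zero]
    rw [Polynomial.aeval_algebraMap_apply, aeval_X_left_apply]
  refine ⟨Polynomial.aeval (MvPolynomial.X 0) p +
    Polynomial.aeval (MvPolynomial.X 0) q * MvPolynomial.X 1, ?_⟩
  rw [map_add, map_mul, h, h]
  simp [polyToCurve]

/-- Composed with `toCurveLoc` it becomes the localization map of a domain at a nonzero element. -/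
theorem ofCurve_injective [CharZero C] : Function.Injective (ofCurve C) := by
  have h (a : CurveRing C) : toCurveLoc C (ofCurve C a) = algebraMap _ _ a := by
    obtain ⟨p, rfl⟩ := polyToCurve_surjective C a
    rw [ofCurve_polyToCurve, toCurveLoc_mk]
  intro a b hab
  refine IsLocalization.injective (Localization.Away (curveDelta C))
    (powers_le_nonZeroDivisors_of_noZeroDivisors (curveDelta_ne_zero C)) ?_
  rw [← h, hab, h]

theorem exists_pow_mul_eq_ofCurve (z : S C) :
    ∃ (n : ℕ) (a : CurveRing C), (3 * s C ^ 2 - 1) ^ n * z = ofCurve C a := by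
  obtain ⟨z, rfl⟩ := Ideal.Quotient.mk_surjective z
  obtain ⟨n, p, h⟩ := IsLocalization.Away.surj (delta C) z
  refine ⟨n, polyToCurve C p, ?_⟩
  rw [ofCurve_polyToCurve, ← h, map_mul, map_pow, mul_comm, ← ofCurve_delta, ← polyToCurve_delta,
    ofCurve_polyToCurve]

theorem isLocalization_ofCurve [CharZero C] :
    letI := (ofCurve C).toAlgebra
    IsLocalization.Away (curveDelta C) (S C) := by
  let := (ofCurve C).toAlgebra
  refine IsLocalization.Away.mk _ ?_ ?_ ?_
  · exact (ofCurve_delta C).symm ▸ isUnit_delta C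
  · intro z
    obtain ⟨n, a, h⟩ := exists_pow_mul_eq_ofCurve C z
    refine ⟨n, a, ?_⟩
    rw [mul_comm]
    exact (ofCurve_delta C).symm ▸ h
  · exact fun a b h => ⟨0, by rw [ofCurve_injective C h]⟩

instance isDomain_S [CharZero C] : IsDomain (S C) := by
  let := (ofCurve C).toAlgebra
  have := isLocalization_ofCurve C
  exact IsLocalization.isDomain_of_le_nonZeroDivisors (S C)
    (powers_le_nonZeroDivisors_of_noZeroDivisors (curveDelta_ne_zero C))

instance isDedekindDomain_S [CharZero C] : IsDedekindDomain (S C) := by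
  let := (ofCurve C).toAlgebra
  have := isLocalization_ofCurve C
  exact IsLocalization.isDedekindDomain (CurveRing C)
    (powers_le_nonZeroDivisors_of_noZeroDivisors (curveDelta_ne_zero C)) (S C)

end Presentation

/-! ### Valuation rings and primitive scaling of polynomials. -/

section Scaling

variable {K : Type*} [Field K] (V : ValuationSubring K)

/-- Divide by an entry of largest valuation. -/
theorem exists_scaling (T : Finset K) (h : ∃ x ∈ T, x ≠ 0) :
    ∃ c : K, c ≠ 0 ∧ (∀ x ∈ T, c * x ∈ V) ∧ ∃ x ∈ T, c * x = 1 := by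
  obtain ⟨x₀, hx₀, hne⟩ := h
  obtain ⟨y, hy, hmax⟩ := T.exists_max_image V.valuation ⟨x₀, hx₀⟩
  have hy0 : y ≠ 0 := by
    rintro rfl
    have := hmax x₀ hx₀
    rw [map_zero, le_zero_iff, map_eq_zero] at this
    exact hne this
  refine ⟨y⁻¹, inv_ne_zero hy0, fun x hx => ?_, y, hy, inv_mul_cancel₀ hy0⟩
  rw [← V.valuation_le_one_iff, map_mul, map_inv₀]
  refine (mul_le_mul_right (hmax x hx) _).trans ?_
  rw [inv_mul_cancel₀ ((_root_.map_ne_zero _).mpr hy0)]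

/-- Two polynomials, not both zero, can be scaled to be integral at a valuation ring and not both
zero in the residue field. -/
theorem exists_primitive_scaling (p q : K[X]) (h : p ≠ 0 ∨ q ≠ 0) :
    ∃ c : K, c ≠ 0 ∧ ∃ P Q : V[X],
      P.map (algebraMap V K) = C c * p ∧ Q.map (algebraMap V K) = C c * q ∧
      (P.map (IsLocalRing.residue V) ≠ 0 ∨ Q.map (IsLocalRing.residue V) ≠ 0) := by
  classical
  obtain ⟨c, hc, hV, hu⟩ := exists_scaling V (p.coeffs ∪ q.coeffs) (by
    rcases h with h | h
    · exact ⟨p.leadingCoeff, Finset.mem_union_left _ (coeff_mem_coeffs (by simpa using h)),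
        by simpa using h⟩
    · exact ⟨q.leadingCoeff, Finset.mem_union_right _ (coeff_mem_coeffs (by simpa using h)),
        by simpa using h⟩)
  have key (r : K[X]) (hr : r.coeffs ⊆ p.coeffs ∪ q.coeffs) :
      ∃ R : V[X], R.map (algebraMap V K) = C c * r := by
    refine (mem_lifts _).mp ((lifts_iff_coeff_lifts _).mpr fun n => ?_)
    rw [coeff_C_mul]
    by_cases h0 : r.coeff n = 0
    · exact ⟨0, by rw [h0, mul_zero, map_zero]⟩
    · exact ⟨⟨_, hV _ (hr (coeff_mem_coeffs h0))⟩, rfl⟩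
  have key2 (r : K[X]) (R : V[X]) (hR : R.map (algebraMap V K) = C c * r)
      (hr : ∃ x ∈ r.coeffs, c * x = 1) : R.map (IsLocalRing.residue V) ≠ 0 := by
    obtain ⟨x, hx, hcx⟩ := hr
    obtain ⟨n, -, rfl⟩ := mem_coeffs_iff.mp hx
    intro h0
    have h1 : R.coeff n = 1 := by
      apply FaithfulSMul.algebraMap_injective V K
      rw [← coeff_map, hR, coeff_C_mul, hcx, map_one]
    have := congrArg (fun f => f.coeff n) h0
    simp [h1] at this
  obtain ⟨P, hP⟩ := key p Finset.subset_union_left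
  obtain ⟨Q, hQ⟩ := key q Finset.subset_union_right
  refine ⟨c, hc, P, Q, hP, hQ, ?_⟩
  obtain ⟨x, hx, hcx⟩ := hu
  rcases Finset.mem_union.mp hx with hx | hx
  · exact Or.inl (key2 p P hP ⟨x, hx, hcx⟩)
  · exact Or.inr (key2 q Q hQ ⟨x, hx, hcx⟩)

/-- A field of characteristic zero has a valuation ring of residue characteristic three. -/
theorem exists_valuationSubring_three (K : Type*) [Field K] [CharZero K] :
    ∃ V : ValuationSubring K, (3 : IsLocalRing.ResidueField V) = 0 := by
  let A : Subring K := (Int.castRingHom K).range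
  let J : Ideal A := Ideal.span {3}
  have hJ : J ≠ ⊤ := by
    rw [Ne, Ideal.span_singleton_eq_top]
    intro h
    obtain ⟨⟨_, m, rfl⟩, hm⟩ := h.exists_right_inv
    have h2 : (3 : K) * m = 1 := congrArg Subtype.val hm
    have h3 : (3 : ℤ) * m = 1 := by exact_mod_cast h2
    omega
  -- 3 is not a unit in the image of ℤ, so some valuation ring of `K` has it as a nonunit.
  obtain ⟨V, -, hV⟩ := J.image_subset_nonunits_valuationSubring hJ
  refine ⟨V, ?_⟩
  have h3 : (3 : K) ∈ V.nonunits := hV ⟨3, Ideal.subset_span rfl, rfl⟩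
  rw [← SetLike.mem_coe, ← V.image_maximalIdeal] at h3
  obtain ⟨x, hx, hx3⟩ := h3
  have : x = 3 := Subtype.ext hx3
  subst this
  have := (IsLocalRing.residue_eq_zero_iff _).mpr hx
  rwa [map_ofNat] at this

end Scaling

/-! ### Norms and reduction to characteristic 3. -/

namespace CurveRing

theorem norm_algebraMap {k : Type*} [CommRing k] (p : k[X]) :
    Algebra.norm k[X] (algebraMap k[X] (CurveRing k) p) = p ^ 2 := by
  have h := norm_eq p 0
  rw [zero_smul, add_zero, ← Algebra.algebraMap_eq_smul_one] at h
  rw [h]; ring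

/-- Scale g = p + qy so that its reduction is nonzero. Modulo the maximal ideal 3X² - 1 becomes -1,
so the reduction of w is a constant, and a nonzero one since nonzero elements have nonzero norm. The
reduced norm is then a constant times X, contradicting `natDegree_norm_ne_one`. -/
theorem norm_ne_X_mul {K : Type*} [Field K] [CharZero K] (g : CurveRing K) {w z : K[X]} {m : ℕ}
    (hg : Algebra.norm K[X] g = X * w) (hw : w * z = (3 * X ^ 2 - 1) ^ m) : False := by
  obtain ⟨V, hV⟩ := exists_valuationSubring_three K
  have hι : Function.Injective (algebraMap V K) := FaithfulSMul.algebraMap_injective V K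
  have hδ : (3 * X ^ 2 - 1 : K[X]) ≠ 0 := fun h => by
    have := congrArg (Polynomial.eval 0) h
    simp at this
  have hw0 : w ≠ 0 := left_ne_zero_of_mul (hw ▸ pow_ne_zero m hδ)
  have hz0 : z ≠ 0 := right_ne_zero_of_mul (hw ▸ pow_ne_zero m hδ)
  obtain ⟨p, q, rfl⟩ := CoordinateRing.exists_smul_basis_eq g
  rw [norm_eq] at hg
  obtain ⟨c, hc, P, Q, hP, hQ, hPQ⟩ := exists_primitive_scaling V p q <| by
    by_contra! h
    rw [h.1, h.2] at hg
    refine mul_ne_zero X_ne_zero hw0 (hg.symm.trans (by ring))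
  -- Pairing z with 0 forces the scaled z itself to have nonzero reduction.
  obtain ⟨c', -, Z, Z', hZ, hZ', hZ0⟩ := exists_primitive_scaling V z 0 (Or.inl hz0)
  have hZ'0 : Z' = 0 := (Polynomial.map_eq_zero_iff hι).mp (by rw [hZ', mul_zero])
  replace hZ0 : Z.map (IsLocalRing.residue V) ≠ 0 :=
    hZ0.resolve_right (not_not_intro (by rw [hZ'0, Polynomial.map_zero]))
  set W := (P ^ 2 - Q ^ 2 * (X ^ 3 - X)).divX with hWdef
  have hN : (P ^ 2 - Q ^ 2 * (X ^ 3 - X)).map (algebraMap V K) = X * (C (c ^ 2) * w) := by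
    simp only [Polynomial.map_sub, Polynomial.map_mul, Polynomial.map_pow, hP, hQ, map_X, C_pow]
    linear_combination C c ^ 2 * hg
  have hNW : P ^ 2 - Q ^ 2 * (X ^ 3 - X) = X * W := by
    have h0 : (P ^ 2 - Q ^ 2 * (X ^ 3 - X)).coeff 0 = 0 := hι (by
      rw [← coeff_map, hN, map_zero, coeff_X_mul_zero])
    conv_lhs => rw [← X_mul_divX_add (P ^ 2 - Q ^ 2 * (X ^ 3 - X)), h0, C_0, add_zero]
  have hW : W.map (algebraMap V K) = C (c ^ 2) * w := by
    refine mul_left_cancel₀ X_ne_zero ?_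
    rw [← hN, hNW, Polynomial.map_mul, map_X]
  obtain ⟨u, hu⟩ : ∃ u : V, W * Z = C u * (3 * X ^ 2 - 1) ^ m := by
    -- The scalar is read off at X = 0, where 3X² - 1 takes the value -1; this shows that it lies in
    -- `V`.
    refine ⟨(W * Z).coeff 0 * (-1) ^ m, map_injective _ hι ?_⟩
    have h1 : (W * Z).map (algebraMap V K) = C (c ^ 2 * c') * (3 * X ^ 2 - 1) ^ m := by
      rw [Polynomial.map_mul, hW, hZ, ← hw, C_mul]; ring
    have h2 : algebraMap V K ((W * Z).coeff 0 * (-1) ^ m) = c ^ 2 * c' := by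
      rw [map_mul, ← coeff_map, h1, coeff_C_mul, coeff_zero_eq_eval_zero]
      simp [mul_assoc, ← mul_pow]
    rw [h1, Polynomial.map_mul, map_C, h2]
    simp
  set ρ := IsLocalRing.residue V
  have hWZ : W.map ρ * Z.map ρ = C (ρ u * (-1) ^ m) := by
    rw [← Polynomial.map_mul, hu]
    simp only [Polynomial.map_mul, Polynomial.map_pow, Polynomial.map_sub, Polynomial.map_ofNat,
      map_C, map_X, Polynomial.map_one]
    rw [← map_ofNat C 3, hV]
    simp
  have hnorm : Algebra.norm _ (P.map ρ • (1 : CurveRing (IsLocalRing.ResidueField V)) +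
      Q.map ρ • CoordinateRing.mk (curve _) X) = X * W.map ρ := by
    have := congrArg (Polynomial.map ρ) hNW
    simp only [Polynomial.map_sub, Polynomial.map_mul, Polynomial.map_pow, map_X] at this
    rw [norm_eq, this]
  have hW0 : W.map ρ ≠ 0 := by
    intro h
    rw [h, mul_zero, Algebra.norm_eq_zero_iff] at hnorm
    obtain ⟨h1, h2⟩ := CoordinateRing.smul_basis_eq_zero hnorm
    exact hPQ.elim (absurd h1) (absurd h2)
  have hdeg : (W.map ρ).natDegree = 0 := by
    have := congrArg natDegree hWZ
    rw [natDegree_mul hW0 hZ0, natDegree_C] at this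
    omega
  refine CoordinateRing.natDegree_norm_ne_one _ (congrArg natDegree hnorm |>.trans ?_)
  rw [natDegree_X_mul hW0, hdeg]

end CurveRing

/-! ### The ideal (s, t) is not principal. -/

section NonPrincipal

variable (C : Type*) [Field C]

/-- The curve equation gives t² = s(s² - 1) for one inclusion and s = s·s² - t² for the other. -/
theorem I_mul_I : I C * I C = Ideal.span {s C} := by
  have h := curve_spec C
  refine le_antisymm ?_ ?_
  · rw [I, Ideal.span_pair_mul_span_pair, Ideal.span_le]
    rintro _ (rfl | rfl | rfl | rfl)
    all_goals refine Ideal.mem_span_singleton'.mpr ?_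
    · exact ⟨s C, rfl⟩
    · exact ⟨t C, mul_comm _ _⟩
    · exact ⟨t C, rfl⟩
    · exact ⟨s C ^ 2 - 1, by linear_combination h⟩
  · rw [Ideal.span_singleton_le_iff_mem]
    have hs : s C ∈ I C := Ideal.subset_span (Or.inl rfl)
    have ht : t C ∈ I C := Ideal.subset_span (Or.inr rfl)
    have : s C = s C * (s C * s C) - t C * t C := by linear_combination -h
    rw [this]
    exact sub_mem (Ideal.mul_mem_left _ _ (Ideal.mul_mem_mul hs hs)) (Ideal.mul_mem_mul ht ht)

/-- If I = (g), then g² and s are associated. Replace g by a multiple a from the coordinate ring,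
clear denominators in both divisibilities and take norms. With δ = 3X² - 1, one relation shows that
X divides N(a) = Xw, and the other becomes w · (w N(b)) = δ^(2k), which `norm_ne_X_mul` excludes. -/
theorem not_isPrincipal_I [CharZero C] : ¬ (I C).IsPrincipal := by
  rintro ⟨g, hg⟩
  have hI := I_mul_I C
  rw [hg, Ideal.submodule_span_eq, Ideal.span_singleton_mul_span_singleton] at hI
  obtain ⟨n, a, ha⟩ := exists_pow_mul_eq_ofCurve C g
  have hδ := isUnit_delta C
  obtain ⟨v, hv⟩ : ofCurve C a * ofCurve C a ∣ s C := by
    have : g * g ∣ s C := Ideal.mem_span_singleton.mp (hI ▸ Ideal.subset_span rfl)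
    rw [← ha, show ∀ x : S C, x * g * (x * g) = x * x * (g * g) by intros; ring]
    exact ((hδ.pow n).mul (hδ.pow n)).mul_left_dvd.mpr this
  obtain ⟨u, hu⟩ : s C ∣ ofCurve C a * ofCurve C a := by
    have : s C ∣ g * g := Ideal.mem_span_singleton.mp (hI ▸ Ideal.subset_span rfl)
    rw [← ha, mul_mul_mul_comm]
    exact this.mul_left _
  obtain ⟨k, b, hb⟩ := exists_pow_mul_eq_ofCurve C v
  obtain ⟨l, c, hc⟩ := exists_pow_mul_eq_ofCurve C u
  have hx : ofCurve C (algebraMap C[X] _ X) = s C := by rw [ofCurve_algebraMap, aeval_X]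
  have h1 : curveDelta C ^ k * algebraMap C[X] _ X = a * a * b := ofCurve_injective C <| by
    rw [map_mul, map_pow, ofCurve_delta, hx, map_mul, map_mul, ← hb]
    linear_combination (3 * s C ^ 2 - 1) ^ k * hv
  have h2 : curveDelta C ^ l * (a * a) = algebraMap C[X] _ X * c := ofCurve_injective C <| by
    rw [map_mul, map_pow, ofCurve_delta, map_mul, map_mul, hx, ← hc]
    linear_combination (3 * s C ^ 2 - 1) ^ l * hu
  have n1 := congrArg (Algebra.norm C[X]) h1
  have n2 := congrArg (Algebra.norm C[X]) h2
  simp only [map_mul, map_pow, curveDelta, CurveRing.norm_algebraMap] at n1 n2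
  have hdvd : X ∣ Algebra.norm C[X] a := by
    have hX := prime_X (R := C)
    have h3 : X ∣ ((3 * X ^ 2 - 1 : C[X]) ^ 2) ^ l * (Algebra.norm C[X] a * Algebra.norm C[X] a) :=
      ⟨X * Algebra.norm C[X] c, by rw [n2]; ring⟩
    rcases hX.dvd_or_dvd h3 with h | h
    · have := hX.dvd_of_dvd_pow (hX.dvd_of_dvd_pow h)
      rw [X_dvd_iff, coeff_zero_eq_eval_zero] at this
      simp at this
    · exact (hX.dvd_or_dvd h).elim id id
  obtain ⟨w, hw⟩ := hdvd
  refine CurveRing.norm_ne_X_mul a (w := w) (z := w * Algebra.norm C[X] b) (m := 2 * k) hw ?_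
  refine mul_left_cancel₀ (pow_ne_zero 2 (X_ne_zero (R := C))) ?_
  rw [hw] at n1
  rw [pow_mul]
  linear_combination -n1

end NonPrincipal

/-! ### Invertible modules and the isomorphism of `M` with `I`. -/

/-- A nonzero ideal of a Dedekind domain is an invertible module. -/
theorem invertible_ideal {R : Type*} [CommRing R] [IsDedekindDomain R] {J : Ideal R} (hJ : J ≠ ⊥) :
    Module.Invertible R J := by
  let K := FractionRing R
  have h0 : (J : FractionalIdeal (nonZeroDivisors R) K) ≠ 0 :=
    FractionalIdeal.coeIdeal_ne_zero.mpr hJ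
  let u : (Submodule R K)ˣ :=
    Units.map (FractionalIdeal.coeSubmoduleHom (nonZeroDivisors R) K).toMonoidHom (Units.mk0 _ h0)
  have e : J ≃ₗ[R] (u : Submodule R K) :=
    Submodule.equivMapOfInjective (Algebra.linearMap R K) (IsFractionRing.injective R K) J
  exact Module.Invertible.congr e.symm

theorem rankAtStalk_eq_one_of_invertible (R N : Type*) [CommRing R] [AddCommGroup N] [Module R N]
    [Module.Invertible R N] (p : PrimeSpectrum R) : Module.rankAtStalk (R := R) N p = 1 :=
  Module.Invertible.finrank_eq_one _ _

theorem isNonFreeProjectiveOfRankOne_of_invertible {R N : Type*} [CommRing R] [AddCommGroup N]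
    [Module R N] [Module.Invertible R N] (h : ¬ Module.Free R N) :
    IsNonFreeProjectiveOfRankOne R N :=
  ⟨inferInstance, inferInstance, rankAtStalk_eq_one_of_invertible R N, h⟩

section Modules

variable (C : Type*) [Field C] [CharZero C]

theorem s_ne_zero : s C ≠ 0 := by
  intro h
  have hx : ofCurve C (algebraMap C[X] _ X) = s C := by rw [ofCurve_algebraMap, aeval_X]
  rw [h, ← map_zero (ofCurve C)] at hx
  have := ofCurve_injective C hx
  rw [← map_zero (algebraMap C[X] _)] at this
  exact X_ne_zero (FaithfulSMul.algebraMap_injective C[X] (CurveRing C) this)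

theorem I_ne_bot : I C ≠ ⊥ := fun h => s_ne_zero C <| by
  have : s C ∈ I C := Ideal.subset_span (Or.inl rfl)
  rwa [h, Ideal.mem_bot] at this

/-- The linear map `S² → S` with `e₁ ↦ s` and `e₂ ↦ t`. -/
noncomputable def toS : (Fin 2 → S C) →ₗ[S C] S C := Fintype.linearCombination (S C) ![s C, t C]

omit [CharZero C] in
theorem toS_apply (v : Fin 2 → S C) : toS C v = v 0 * s C + v 1 * t C := by
  simp [toS, Fintype.linearCombination_apply]

/-- Let v₀s + v₁t = 0. Multiplying by t, substituting t² = s(s² - 1) and cancelling s gives v₀t = (1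
- s²)v₁. These two equations express v as -s v₁ times the first relation plus -v₀ times the second.
-/
theorem ker_toS : LinearMap.ker (toS C) = relations C := by
  have h := curve_spec C
  refine le_antisymm ?_ ?_
  · intro v hv
    rw [LinearMap.mem_ker, toS_apply] at hv
    have h1 : v 0 * t C = (1 - s C ^ 2) * v 1 := by
      refine mul_left_cancel₀ (s_ne_zero C) ?_
      linear_combination t C * hv + v 1 * h
    refine Submodule.mem_span_pair.mpr ⟨-s C * v 1, -v 0, ?_⟩
    ext i
    fin_cases i
    · simp
      linear_combination (-s C) * hv
    · simp
      linear_combination h1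
  · rw [relations, Submodule.span_le]
    rintro _ (rfl | rfl)
    · simp [toS_apply]; ring
    · simp [toS_apply]; linear_combination h

omit [CharZero C] in
theorem range_toS : LinearMap.range (toS C) = I C := by
  rw [toS, Fintype.range_linearCombination]
  simp [I, Ideal.span, Set.pair_comm]

/-- The isomorphism `M ≃ I`. -/
noncomputable def equivI : M C ≃ₗ[S C] I C :=
  Submodule.quotEquivOfEq _ _ (ker_toS C).symm ≪≫ₗ (toS C).quotKerEquivRange ≪≫ₗ
    LinearEquiv.ofEq _ _ (range_toS C)

theorem equivI_f₁ : (equivI C (f₁ C) : S C) = s C :=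
  (toS_apply C (Pi.single 0 1)).trans (by simp)

theorem equivI_f₂ : (equivI C (f₂ C) : S C) = t C :=
  (toS_apply C (Pi.single 1 1)).trans (by simp)

instance invertible_I : Module.Invertible (S C) (I C) := invertible_ideal (I_ne_bot C)

instance invertible_M : Module.Invertible (S C) (M C) := .congr (equivI C).symm

/-- A free invertible module is isomorphic to the ring, and the image of 1 would generate the ideal.
-/
theorem not_free_I : ¬ Module.Free (S C) (I C) := by
  intro h
  obtain ⟨e⟩ := Module.Invertible.free_iff_linearEquiv.mp h
  refine not_isPrincipal_I C ⟨(e.symm 1 : I C), ?_⟩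
  refine le_antisymm (fun x hx => ?_) ?_
  · refine Submodule.mem_span_singleton.mpr ⟨e ⟨x, hx⟩, ?_⟩
    rw [← Submodule.coe_smul, ← map_smul, smul_eq_mul, mul_one, e.symm_apply_apply]
  · rw [Submodule.span_singleton_le_iff_mem]
    exact (e.symm 1).2

theorem not_free_M : ¬ Module.Free (S C) (M C) := fun _ =>
  not_free_I C (.of_equiv (equivI C))

end Modules

/-! ### Divided powers of derivations and connections. -/

section DividedPowers

variable {k R N : Type*} [Field k] [CharZero k] [CommRing R] [Algebra k R] [AddCommGroup N]
  [Module k N] [Module R N] [IsScalarTower k R N]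

/-- The divided power `dⁿ / n!` of a linear endomorphism. -/
noncomputable def divPow (d : N →ₗ[k] N) (n : ℕ) : N →ₗ[k] N := (n.factorial : k)⁻¹ • d ^ n

omit [CharZero k] in
theorem divPow_zero (d : N →ₗ[k] N) : divPow d 0 = 1 := by simp [divPow]

omit [CharZero k] in
theorem divPow_one (d : N →ₗ[k] N) : divPow d 1 = d := by simp [divPow]

theorem succ_smul_divPow_succ (d : N →ₗ[k] N) (n : ℕ) (x : N) :
    ((n + 1 : ℕ) : k) • divPow d (n + 1) x = d (divPow d n x) := by
  simp only [divPow, LinearMap.smul_apply, map_smul, smul_smul]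
  rw [pow_succ', Module.End.mul_apply, Nat.factorial_succ, Nat.cast_mul, mul_inv,
    mul_inv_cancel_left₀ (Nat.cast_ne_zero.mpr n.succ_ne_zero)]

theorem divPow_divPow (d : N →ₗ[k] N) (i j : ℕ) (x : N) :
    divPow d i (divPow d j x) = ((i + j).choose i) • divPow d (i + j) x := by
  simp only [divPow, LinearMap.smul_apply, map_smul, smul_smul, ← Nat.cast_smul_eq_nsmul k]
  rw [pow_add, Module.End.mul_apply, Nat.cast_add_choose]
  congr 1
  have h (m : ℕ) : (m.factorial : k) ≠ 0 := Nat.cast_ne_zero.mpr m.factorial_ne_zero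
  field_simp [h]

theorem divPow_smul {d : R →ₗ[k] R} {D : N →ₗ[k] N}
    (h : ∀ r m, D (r • m) = d r • m + r • D m) (n : ℕ) (r : R) (m : N) :
    divPow D n (r • m) =
      ∑ ij ∈ Finset.HasAntidiagonal.antidiagonal n, divPow d ij.1 r • divPow D ij.2 m := by
  induction n with
  | zero => simp [divPow_zero]
  | succ n ih =>
    have hn : ((n + 1 : ℕ) : k) ≠ 0 := Nat.cast_ne_zero.mpr n.succ_ne_zero
    refine smul_right_injective N hn ?_
    simp only
    rw [succ_smul_divPow_succ, ih, map_sum, Finset.smul_sum]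
    -- Splitting n + 1 = i + j lowers one index in each half, which matches the two terms of the
    -- Leibniz rule for `D`.
    have key : ∀ ij ∈ Finset.HasAntidiagonal.antidiagonal (n + 1),
        ((n + 1 : ℕ) : k) • (divPow d ij.1 r • divPow D ij.2 m) =
          ((ij.1 : k) • divPow d ij.1 r) • divPow D ij.2 m +
            divPow d ij.1 r • ((ij.2 : k) • divPow D ij.2 m) := by
      intro ij hij
      rw [← Finset.HasAntidiagonal.mem_antidiagonal.mp hij, Nat.cast_add, add_smul,
        smul_assoc, smul_comm (ij.2 : k)]
    rw [Finset.sum_congr rfl key, Finset.sum_add_distrib,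
      Finset.Nat.sum_antidiagonal_succ, Finset.Nat.sum_antidiagonal_succ' (n := n)]
    simp only [Nat.cast_zero, zero_smul, smul_zero, zero_add, succ_smul_divPow_succ, h,
      Finset.sum_add_distrib]

/-- In characteristic zero a derivation extends to an iterative derivation. -/
noncomputable def IterativeDerivation.ofDerivation (d : Derivation k R R) :
    IterativeDerivation R where
  θ n := (divPow d.toLinearMap n).toAddMonoidHom
  zero' r := by simp [divPow_zero]
  leibniz' n r m := divPow_smul (d := d.toLinearMap) (D := d.toLinearMap)
    (fun r m => by simp [mul_comm, add_comm]) n r m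
  iterate' i j r := divPow_divPow d.toLinearMap i j r

theorem IterativeDerivation.ofDerivation_θ (d : Derivation k R R) (n : ℕ) (r : R) :
    (IterativeDerivation.ofDerivation d).θ n r = divPow d.toLinearMap n r := rfl

/-- In characteristic zero a connection extends to an iterative derivation. -/
noncomputable def ModuleIterativeDerivation.ofConnection (d : Derivation k R R) (D : N →ₗ[k] N)
    (h : ∀ r m, D (r • m) = d r • m + r • D m) :
    ModuleIterativeDerivation (IterativeDerivation.ofDerivation d) N where
  θ n := (divPow D n).toAddMonoidHom
  zero' r := by simp [divPow_zero]
  leibniz' n r m := divPow_smul (d := d.toLinearMap) h n r m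
  iterate' i j r := divPow_divPow D i j r

theorem ModuleIterativeDerivation.ofConnection_θ_one (d : Derivation k R R) (D : N →ₗ[k] N)
    (h : ∀ r m, D (r • m) = d r • m + r • D m) (m : N) :
    (ModuleIterativeDerivation.ofConnection d D h).θ 1 m = D m :=
  congrArg (fun φ => φ m) (divPow_one D)

end DividedPowers

/-! ### Iterative derivations are determined in degree 1. -/

section Determined

variable {R N : Type*} [CommRing R] [AddCommGroup N] [Module R N]

theorem eq_of_succ_nsmul_eq (k : Type*) [Field k] [CharZero k] [Module k N] {x y : N}
    (n : ℕ) (h : (n + 1) • x = (n + 1) • y) : x = y := by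
  rw [← Nat.cast_smul_eq_nsmul k, ← Nat.cast_smul_eq_nsmul k] at h
  exact smul_right_injective N (Nat.cast_ne_zero.mpr n.succ_ne_zero) h

/-- In characteristic zero an iterative derivation is determined by its first map. -/
theorem IterativeDerivation.ext_of_one (k : Type*) [Field k] [CharZero k] [Module k R]
    {D D' : IterativeDerivation R}
    (h : ∀ r, D.θ 1 r = D'.θ 1 r) : D = D' := by
  ext n r
  induction n with
  | zero => rw [D.zero', D'.zero']
  | succ n ih =>
    refine eq_of_succ_nsmul_eq k n ?_
    -- The iteration rule reads θ⁽¹⁾θ⁽ⁿ⁾ = (n + 1)θ⁽ⁿ⁺¹⁾.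
    have h1 := D.iterate' 1 n r
    have h2 := D'.iterate' 1 n r
    rw [Nat.choose_one_right, add_comm 1 n] at h1 h2
    rw [← h1, ← h2, ih, h]

/-- In characteristic zero a module iterative derivation is determined by its first map. -/
theorem ModuleIterativeDerivation.ext_of_one (k : Type*) [Field k] [CharZero k] [Module k N]
    {D₀ : IterativeDerivation R}
    {D D' : ModuleIterativeDerivation D₀ N} (h : ∀ m, D.θ 1 m = D'.θ 1 m) : D = D' := by
  ext n m
  induction n with
  | zero => rw [D.zero', D'.zero']
  | succ n ih =>
    refine eq_of_succ_nsmul_eq k n ?_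
    have h1 := D.iterate' 1 n m
    have h2 := D'.iterate' 1 n m
    rw [Nat.choose_one_right, add_comm 1 n] at h1 h2
    rw [← h1, ← h2, ih, h]

theorem IterativeDerivation.θ_one_mul (D : IterativeDerivation R) (x y : R) :
    D.θ 1 (x * y) = x * D.θ 1 y + D.θ 1 x * y := by
  rw [D.leibniz']
  simp [Finset.Nat.antidiagonal_succ, D.zero']

theorem ModuleIterativeDerivation.θ_one_smul {D₀ : IterativeDerivation R}
    (D : ModuleIterativeDerivation D₀ N) (x : R) (m : N) :
    D.θ 1 (x • m) = x • D.θ 1 m + D₀.θ 1 x • m := by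
  rw [D.leibniz']
  simp [Finset.Nat.antidiagonal_succ, D.zero', D₀.zero']

end Determined

/-! ### The derivation d/dt on `S` and ID-simplicity. -/

section Derivation

variable (C : Type*) [Field C]

theorem exists_pow_mul_eq_aeval (z : S C) : ∃ (n : ℕ) (p q : C[X]),
    (3 * s C ^ 2 - 1) ^ n * z = aeval (s C) p + aeval (s C) q * t C := by
  obtain ⟨n, a, h⟩ := exists_pow_mul_eq_ofCurve C z
  obtain ⟨p, q, rfl⟩ := CurveRing.exists_eq a
  exact ⟨n, p, q, by rw [h, map_add, map_mul, ofCurve_y, ofCurve_algebraMap, ofCurve_algebraMap]⟩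

theorem S_algHom_ext {B : Type*} [CommRing B] [Algebra C B] {f g : S C →ₐ[C] B}
    (hs : f (s C) = g (s C)) (ht : f (t C) = g (t C)) : f = g := by
  ext z
  obtain ⟨n, p, q, h⟩ := exists_pow_mul_eq_aeval C z
  have hf := congrArg f h
  have hg := congrArg g h
  rw [map_mul, map_add, map_mul, ← Polynomial.aeval_algHom_apply,
    ← Polynomial.aeval_algHom_apply] at hf hg
  have hδ : f ((3 * s C ^ 2 - 1) ^ n) = g ((3 * s C ^ 2 - 1) ^ n) := by
    simp only [map_pow, map_sub, map_mul, map_one, map_ofNat, hs]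
  rw [hs, ht, ← hg, hδ] at hf
  exact (((isUnit_delta C).pow n).map g).mul_left_cancel hf

/-- This is the differentiated curve equation. As 3s² - 1 is a unit, D(s) is determined by D(t). -/
theorem derivation_s (D : Derivation C (S C) (S C)) :
    (3 * s C ^ 2 - 1) * D (s C) = 2 * t C * D (t C) := by
  have h := congrArg D (curve_spec C)
  simp only [map_sub, Derivation.leibniz_pow, smul_eq_mul, nsmul_eq_mul] at h
  push_cast at h
  linear_combination h

theorem S_derivation_ext {d d' : Derivation C (S C) (S C)} (ht : d (t C) = d' (t C)) :
    d = d' := by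
  have hδ := isUnit_delta C
  have hs : d (s C) = d' (s C) := hδ.mul_left_cancel (by rw [derivation_s, derivation_s, ht])
  ext z
  obtain ⟨n, p, q, h⟩ := exists_pow_mul_eq_aeval C z
  have h1 := congrArg d h
  have h2 := congrArg d' h
  have hδd : d ((3 * s C ^ 2 - 1) ^ n) = d' ((3 * s C ^ 2 - 1) ^ n) := by
    have e : (3 * s C ^ 2 - 1) ^ n = aeval (s C) ((3 * X ^ 2 - 1 : C[X]) ^ n) := by
      simp only [map_pow, map_sub, map_mul, map_one, map_ofNat, aeval_X]
    rw [e, Derivation.map_aeval, Derivation.map_aeval, hs]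
  rw [Derivation.leibniz, map_add, Derivation.leibniz, Derivation.map_aeval, Derivation.map_aeval]
    at h1 h2
  rw [hs, ht, hδd, ← h2] at h1
  exact (hδ.pow n).mul_left_cancel (add_right_cancel h1)

/-- The universal property of `S`. -/
theorem exists_S_algHom {B : Type*} [CommRing B] [Algebra C B] {x y : B}
    (hu : IsUnit (3 * x ^ 2 - 1)) (h : x ^ 3 - x = y ^ 2) :
    ∃ f : S C →ₐ[C] B, f (s C) = x ∧ f (t C) = y := by
  let φ : Poly C →ₐ[C] B := MvPolynomial.aeval ![x, y]
  have hφ0 : φ (MvPolynomial.X 0) = x := MvPolynomial.aeval_X _ _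
  have hφ1 : φ (MvPolynomial.X 1) = y := MvPolynomial.aeval_X _ _
  have hδ : φ (delta C) = 3 * x ^ 2 - 1 := by
    simp only [delta, map_sub, map_mul, map_pow, map_one, map_ofNat, hφ0]
  let ψ : PolyLoc C →ₐ[C] B :=
    IsLocalization.liftAlgHom (M := Submonoid.powers (delta C)) (f := φ) <| by
      rintro ⟨_, n, rfl⟩
      exact (map_pow φ (delta C) n).symm ▸ (hδ.symm ▸ hu).pow n
  have hψ (p : Poly C) : ψ (algebraMap (Poly C) (PolyLoc C) p) = φ p :=
    IsLocalization.lift_eq (M := Submonoid.powers (delta C)) (S := PolyLoc C) (g := φ.toRingHom) _ p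
  have hker : ∀ a ∈ Ideal.span {curveEq C}, ψ a = 0 := by
    intro a ha
    obtain ⟨b, rfl⟩ := Ideal.mem_span_singleton'.mp ha
    rw [map_mul, curveEq, hψ]
    simp only [map_sub, map_pow, hφ0, hφ1, h, sub_self, mul_zero]
  exact ⟨Ideal.Quotient.liftₐ _ ψ hker, (hψ _).trans hφ0, (hψ _).trans hφ1⟩

/-- A lift of the point `(x, y)` of the curve to the dual numbers. -/
theorem dual_curve_eq {R : Type*} [CommRing R] {x y e : R} (h : x ^ 3 - x = y ^ 2)
    (he : (3 * x ^ 2 - 1) * e = 1) :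
    (TrivSqZeroExt.inl x + TrivSqZeroExt.inr (2 * y * e) : TrivSqZeroExt R R) ^ 3 -
      (TrivSqZeroExt.inl x + TrivSqZeroExt.inr (2 * y * e)) =
        (TrivSqZeroExt.inl y + TrivSqZeroExt.inr 1) ^ 2 := by
  ext
  · simpa using h
  · simp
    linear_combination (2 * y) * he

theorem dual_isUnit {R : Type*} [CommRing R] {x e : R} (u : R) (he : (3 * x ^ 2 - 1) * e = 1) :
    IsUnit (3 * (TrivSqZeroExt.inl x + TrivSqZeroExt.inr u : TrivSqZeroExt R R) ^ 2 - 1) := by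
  rw [TrivSqZeroExt.isUnit_iff_isUnit_fst]
  refine .of_mul_eq_one e ?_
  rw [← he]
  have h3 : (3 : TrivSqZeroExt R R).fst = 3 := rfl
  simp [h3]

/-- An algebra section of `R[ε] → R` defines a derivation. -/
theorem exists_derivation_of_dual {k R : Type*} [CommRing k] [CommRing R] [Algebra k R]
    (f : R →ₐ[k] TrivSqZeroExt R R) (hf : ∀ x, (f x).fst = x) :
    ∃ d : Derivation k R R, ∀ x, d x = (f x).snd :=
  ⟨Derivation.mk' ((TrivSqZeroExt.sndHom R R).restrictScalars k ∘ₗ f.toLinearMap)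
    fun a b => by simp [hf, mul_comm], fun _ => rfl⟩

/-- The universal property of `S` gives a map to the dual numbers with t ↦ t + ε and s ↦ s + 2t/(3s²
- 1) ε; its ε-component is the derivation. -/
theorem exists_derivation : ∃ d : Derivation C (S C) (S C), d (t C) = 1 := by
  obtain ⟨f, hs, ht⟩ := exists_S_algHom C
    (B := TrivSqZeroExt (S C) (S C)) (dual_isUnit (2 * t C * dinv C) (dinv_spec C))
    (dual_curve_eq (curve_spec C) (dinv_spec C))
  have hf (x : S C) : (f x).fst = x := by
    have : (TrivSqZeroExt.fstHom C (S C) (S C)).comp f = AlgHom.id C _ :=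
      S_algHom_ext C
        (by rw [AlgHom.comp_apply, hs, TrivSqZeroExt.fstHom_apply, TrivSqZeroExt.fst_add,
          TrivSqZeroExt.fst_inl, TrivSqZeroExt.fst_inr, add_zero, AlgHom.id_apply])
        (by rw [AlgHom.comp_apply, ht, TrivSqZeroExt.fstHom_apply, TrivSqZeroExt.fst_add,
          TrivSqZeroExt.fst_inl, TrivSqZeroExt.fst_inr, add_zero, AlgHom.id_apply])
    exact congrArg (fun f => f x) this
  obtain ⟨d, hd⟩ := exists_derivation_of_dual f hf
  exact ⟨d, by rw [hd, ht, TrivSqZeroExt.snd_add, TrivSqZeroExt.snd_inl, TrivSqZeroExt.snd_inr,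
    zero_add]⟩

/-- The derivation `∂ / ∂t` of `S`. -/
noncomputable def derivT : Derivation C (S C) (S C) := (exists_derivation C).choose

theorem derivT_t : derivT C (t C) = 1 := (exists_derivation C).choose_spec

theorem derivT_s : derivT C (s C) = 2 * t C * dinv C := by
  have h := derivation_s C (derivT C)
  rw [derivT_t, mul_one] at h
  linear_combination dinv C * h - derivT C (s C) * dinv_spec C

theorem derivT_ofPoly (f : C[X]) : derivT C (ofPoly C f) = ofPoly C (derivative f) := by
  have h : ∀ f, ofPoly C f = aeval (t C) f := fun _ => rfl
  rw [h, Derivation.map_aeval, derivT_t, smul_eq_mul, mul_one, h]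

variable [CharZero C]

theorem extendsPolyID_derivT : ExtendsPolyID C (IterativeDerivation.ofDerivation (derivT C)) := by
  intro n f
  rw [IterativeDerivation.ofDerivation_θ]
  have h (n : ℕ) : ((derivT C).toLinearMap ^ n) (ofPoly C f) = ofPoly C (derivative^[n] f) := by
    induction n with
    | zero => rfl
    | succ n ih =>
      rw [pow_succ', Module.End.mul_apply, ih, Function.iterate_succ_apply']
      exact derivT_ofPoly C _
  have hc (c : C) (g : C[X]) : ofPoly C (c • g) = c • ofPoly C g := map_smul (aeval (t C)) c g
  rw [divPow, LinearMap.smul_apply, h, ← hc]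
  congr 1
  have := congrArg (fun φ => φ f) (factorial_smul_hasseDeriv (R := C) n)
  rw [← this, LinearMap.smul_apply, ← Nat.cast_smul_eq_nsmul C, smul_smul,
    inv_mul_cancel₀ (Nat.cast_ne_zero.mpr n.factorial_ne_zero), one_smul]
  rfl

/-- θ⁽¹⁾ kills constants, so it is a C-linear derivation with t ↦ 1, hence equal to `derivT`. -/
theorem unique_of_extendsPolyID (D' : IterativeDerivation (S C)) (h : ExtendsPolyID C D') :
    D' = IterativeDerivation.ofDerivation (derivT C) := by
  have hC (c : C) : D'.θ 1 (algebraMap C (S C) c) = 0 := by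
    have h1 := h 1 (Polynomial.C c)
    have h2 : (polyID C).θ 1 (Polynomial.C c) = 0 := hasseDeriv_C 1 c one_pos
    rwa [h2, map_zero, show ofPoly C (Polynomial.C c) = algebraMap C (S C) c from aeval_C _ _] at h1
  let d : Derivation C (S C) (S C) := Derivation.mk'
    { toFun := D'.θ 1
      map_add' := map_add _
      map_smul' := fun c x => by
        rw [Algebra.smul_def, D'.θ_one_mul, hC, zero_mul, add_zero, ← Algebra.smul_def]
        rfl }
    (fun a b => by simp [D'.θ_one_mul, mul_comm])
  have hd : d = derivT C := S_derivation_ext C <| by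
    have h1 := h 1 X
    have h2 : (polyID C).θ 1 X = 1 := by
      change hasseDeriv 1 X = 1
      rw [hasseDeriv_one', derivative_X]
    rw [h2, map_one, show ofPoly C X = t C from aeval_X _] at h1
    rw [derivT_t]
    exact h1
  refine IterativeDerivation.ext_of_one C fun r => ?_
  rw [IterativeDerivation.ofDerivation_θ, divPow_one, ← hd]
  rfl

-- s is integral over C[t], and the algebraic elements form a subalgebra that also contains the
-- inverse of 3s² - 1.
omit [CharZero C] in
theorem isAlgebraic_S : letI := (ofPoly C).toAlgebra; Algebra.IsAlgebraic C[X] (S C) := by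
  let := (ofPoly C).toAlgebra
  let T := Subalgebra.algebraicClosure C[X] (S C)
  have hX : algebraMap C[X] (S C) X = t C := aeval_X (R := C) (t C)
  have ht : t C ∈ T := hX ▸ T.algebraMap_mem X
  have hs : s C ∈ T := by
    refine IsIntegral.isAlgebraic ⟨X ^ 3 - X - Polynomial.C (X ^ 2), ?_, ?_⟩
    · monicity!
    · simp only [eval₂_sub, eval₂_pow, eval₂_X, eval₂_C, map_pow, hX]
      linear_combination curve_spec C
  have hc (c : C) : algebraMap C (S C) c ∈ T := by
    have h := T.algebraMap_mem (Polynomial.C c)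
    rwa [show algebraMap C[X] (S C) (Polynomial.C c) = algebraMap C (S C) c from aeval_C _ _] at h
  have hp (p : C[X]) : aeval (s C) p ∈ T := by
    rw [aeval_eq_sum_range]
    refine sum_mem fun i _ => ?_
    rw [Algebra.smul_def]
    exact mul_mem (hc _) (pow_mem hs _)
  have hδ : 3 * s C ^ 2 - 1 ∈ T := sub_mem (mul_mem (ofNat_mem T 3) (pow_mem hs 2)) (one_mem T)
  have hdinv : dinv C ∈ T := by
    let : Invertible (3 * s C ^ 2 - 1) :=
      ⟨dinv C, by rw [mul_comm, dinv_spec], dinv_spec C⟩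
    exact IsAlgebraic.invOf (R := C[X]) (x := 3 * s C ^ 2 - 1) hδ
  refine ⟨fun z => ?_⟩
  obtain ⟨n, p, q, h⟩ := exists_pow_mul_eq_aeval C z
  have : z = dinv C ^ n * (aeval (s C) p + aeval (s C) q * t C) := by
    rw [← h, ← mul_assoc, ← mul_pow, mul_comm (dinv C), dinv_spec, one_pow, one_mul]
  rw [this]
  exact mul_mem (pow_mem hdinv n) (add_mem (hp p) (mul_mem (hp q) ht))

/-- By algebraicity a nonzero ideal contains some nonzero f in C[t], and θ⁽ⁿ⁾ with n = deg f sends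
it to its leading coefficient, a unit. -/
theorem isIDSimple_of_extendsPolyID {D : IterativeDerivation (S C)} (hD : ExtendsPolyID C D) :
    IsIDSimple D := by
  refine ⟨inferInstance, fun J hJ => or_iff_not_imp_left.mpr fun hne => ?_⟩
  obtain ⟨x, hx, hx0⟩ := Submodule.exists_mem_ne_zero_of_ne_bot hne
  let := (ofPoly C).toAlgebra
  have := isAlgebraic_S C
  have h := Ideal.comap_ne_bot_of_algebraic_mem hx0 hx
    (Algebra.IsAlgebraic.isAlgebraic (R := C[X]) x)
  obtain ⟨f, hf, hf0⟩ := Submodule.exists_mem_ne_zero_of_ne_bot h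
  have h1 := hJ f.natDegree _ (Ideal.mem_comap.mp hf)
  refine Ideal.eq_top_of_isUnit_mem _ h1 ?_
  have h2 : (polyID C).θ f.natDegree f = Polynomial.C f.leadingCoeff :=
    hasseDeriv_natDegree_eq_C f
  rw [show algebraMap C[X] (S C) = ofPoly C from rfl, hD, h2]
  exact (isUnit_C.mpr (by simpa using hf0)).map _

end Derivation

/-! ### Connections on modules given by generators and relations. -/

section PresentedModule

variable {k R N : Type*} [CommRing k] [CommRing R] [Algebra k R] [AddCommGroup N] [Module k N]
  [Module R N] [IsScalarTower k R N]

/-- The map `R² → N` that sends the basis vectors to `m₁`, `m₂` and satisfies the Leibniz rule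
with respect to `d` and the linear map with values `n₁`, `n₂`. -/
def preConnection (d : Derivation k R R) (n₁ n₂ m₁ m₂ : N) : (Fin 2 → R) →ₗ[k] N where
  toFun v := d (v 0) • n₁ + d (v 1) • n₂ + v 0 • m₁ + v 1 • m₂
  map_add' v w := by
    simp only [Pi.add_apply, map_add, add_smul]
    abel
  map_smul' c v := by
    simp only [Pi.smul_apply, Derivation.map_smul, smul_assoc, RingHom.id_apply, smul_add]

theorem preConnection_apply (d : Derivation k R R) (n₁ n₂ m₁ m₂ : N) (v : Fin 2 → R) :
    preConnection d n₁ n₂ m₁ m₂ v = d (v 0) • n₁ + d (v 1) • n₂ + v 0 • m₁ + v 1 • m₂ := rfl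

theorem preConnection_smul (d : Derivation k R R) (n₁ n₂ m₁ m₂ : N) (r : R) (v : Fin 2 → R) :
    preConnection d n₁ n₂ m₁ m₂ (r • v) =
      d r • (v 0 • n₁ + v 1 • n₂) + r • preConnection d n₁ n₂ m₁ m₂ v := by
  rw [preConnection_apply, preConnection_apply]
  simp only [Pi.smul_apply, smul_eq_mul, Derivation.leibniz]
  match_scalars <;> ring

theorem map_eq_smul_add_smul (q : (Fin 2 → R) →ₗ[R] N) (v : Fin 2 → R) :
    q v = v 0 • q (Pi.single 0 1) + v 1 • q (Pi.single 1 1) := by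
  rw [← map_smul, ← map_smul, ← map_add]
  congr 1
  ext i
  fin_cases i <;> simp

/-- A connection on a module with two generators and two relations is given by its values on the
generators, provided that the relations are respected. -/
theorem exists_connection (d : Derivation k R R) {q : (Fin 2 → R) →ₗ[R] N}
    (hq : Function.Surjective q) {u v : Fin 2 → R}
    (hker : LinearMap.ker q = Submodule.span R {u, v}) (m₁ m₂ : N)
    (hu : preConnection d (q (Pi.single 0 1)) (q (Pi.single 1 1)) m₁ m₂ u = 0)
    (hv : preConnection d (q (Pi.single 0 1)) (q (Pi.single 1 1)) m₁ m₂ v = 0) :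
    ∃ D : N →ₗ[k] N, (∀ r m, D (r • m) = d r • m + r • D m) ∧
      D (q (Pi.single 0 1)) = m₁ ∧ D (q (Pi.single 1 1)) = m₂ := by
  set L := preConnection d (q (Pi.single 0 1)) (q (Pi.single 1 1)) m₁ m₂ with hL
  have hLs (r : R) (w : Fin 2 → R) : L (r • w) = d r • q w + r • L w := by
    rw [hL, preConnection_smul, ← map_eq_smul_add_smul]
  have hle : LinearMap.ker (q.restrictScalars k) ≤ LinearMap.ker L := by
    intro w hw
    -- By the Leibniz rule `L` is `R`-linear up to a term d(r)·q(w), which vanishes on relations, so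
    -- checking the two generators of the kernel suffices.
    have hw' : w ∈ LinearMap.ker q := hw
    have hu' : q u = 0 := by
      rw [← LinearMap.mem_ker, hker]; exact Submodule.subset_span (Or.inl rfl)
    have hv' : q v = 0 := by
      rw [← LinearMap.mem_ker, hker]; exact Submodule.subset_span (Or.inr rfl)
    rw [hker] at hw'
    obtain ⟨a, b, rfl⟩ := Submodule.mem_span_pair.mp hw'
    rw [LinearMap.mem_ker, map_add, hLs, hLs, hu, hv, hu', hv']
    simp only [smul_zero, add_zero]
  let D : N →ₗ[k] N := Submodule.liftQ _ L hle ∘ₗ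
    ((q.restrictScalars k).quotKerEquivOfSurjective hq).symm.toLinearMap
  have hD (w : Fin 2 → R) : D (q w) = L w := by
    have : ((q.restrictScalars k).quotKerEquivOfSurjective hq).symm (q w) =
        Submodule.Quotient.mk w := (LinearEquiv.symm_apply_eq _).mpr rfl
    rw [LinearMap.comp_apply, LinearEquiv.coe_coe, this, Submodule.liftQ_apply]
  refine ⟨D, fun r m => ?_, ?_, ?_⟩
  · obtain ⟨w, rfl⟩ := hq m
    rw [← map_smul, hD, hD, hLs]
  · rw [hD, hL, preConnection_apply]
    simp
  · rw [hD, hL, preConnection_apply]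
    simp

theorem exists_connection_of_curve (d : Derivation k R R) {q : (Fin 2 → R) →ₗ[R] N}
    (hq : Function.Surjective q) {x y e : R} (he : (3 * x ^ 2 - 1) * e = 1)
    (hy : d y = 1) (hx : d x = 2 * y * e)
    (hker : LinearMap.ker q = Submodule.span R {![y, -x], ![x ^ 2 - 1, -y]}) (b : R) :
    ∃ D : N →ₗ[k] N, (∀ r m, D (r • m) = d r • m + r • D m) ∧
      D (q (Pi.single 0 1)) =
        b • q (Pi.single 0 1) + ((3 * x ^ 2 + 1) * e) • q (Pi.single 1 1) ∧
      D (q (Pi.single 1 1)) = x • q (Pi.single 0 1) + b • q (Pi.single 1 1) := by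
  have r₁ : q ![y, -x] = 0 := by
    rw [← LinearMap.mem_ker, hker]; exact Submodule.subset_span (Or.inl rfl)
  have r₂ : q ![x ^ 2 - 1, -y] = 0 := by
    rw [← LinearMap.mem_ker, hker]; exact Submodule.subset_span (Or.inr rfl)
  rw [map_eq_smul_add_smul] at r₁ r₂
  simp only [Matrix.cons_val_zero, Matrix.cons_val_one] at r₁ r₂
  refine exists_connection d hq hker _ _ ?_ ?_
  · rw [preConnection_apply]
    simp only [Matrix.cons_val_zero, Matrix.cons_val_one, map_neg, hy, hx]
    -- Here the f₂-coefficient is y((3x² + 1) - 2)e - xb = y - xb, so the image is b times the first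
    -- relation minus the second.
    linear_combination (norm := module) b • r₁ - r₂ + y • he • q (Pi.single 1 1)
  · have hx2 : d (x ^ 2 - 1) = 4 * x * y * e := by
      rw [map_sub, Derivation.map_one_eq_zero, sq, Derivation.leibniz, hx, smul_eq_mul]
      ring
    rw [preConnection_apply]
    simp only [Matrix.cons_val_zero, Matrix.cons_val_one, map_neg, hy, hx2]
    -- After subtracting the multiples of both relations, the f₂-coefficient is (x² + 1)((3x² - 1)e
    -- - 1) = 0.
    linear_combination (norm := module)
      b • r₂ + (4 * x * e - x) • r₁ + (x ^ 2 + 1) • he • q (Pi.single 1 1)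

theorem ModuleIterativeDerivation.eq_of_generators (k : Type*) [Field k] [CharZero k] [Module k N]
    {D₀ : IterativeDerivation R} {D D' : ModuleIterativeDerivation D₀ N}
    {q : (Fin 2 → R) →ₗ[R] N} (hq : Function.Surjective q)
    (h₁ : D.θ 1 (q (Pi.single 0 1)) = D'.θ 1 (q (Pi.single 0 1)))
    (h₂ : D.θ 1 (q (Pi.single 1 1)) = D'.θ 1 (q (Pi.single 1 1))) : D = D' := by
  refine ModuleIterativeDerivation.ext_of_one k fun m => ?_
  obtain ⟨v, rfl⟩ := hq m
  rw [map_eq_smul_add_smul, map_add, map_add, D.θ_one_smul, D.θ_one_smul, D'.θ_one_smul,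
    D'.θ_one_smul, h₁, h₂]

end PresentedModule

end NonFreeID

theorem mainTheorem3 (C : Type*) [Field C] [CharZero C] :
    IsDedekindDomain (NonFreeID.S C) ∧
    (∃ e : NonFreeID.M C ≃ₗ[NonFreeID.S C] NonFreeID.I C,
      (e (NonFreeID.f₁ C) : NonFreeID.S C) = NonFreeID.s C ∧
      (e (NonFreeID.f₂ C) : NonFreeID.S C) = NonFreeID.t C) ∧
    ¬ (NonFreeID.I C).IsPrincipal ∧
    NonFreeID.IsNonFreeProjectiveOfRankOne (NonFreeID.S C) (NonFreeID.I C) ∧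
    NonFreeID.IsNonFreeProjectiveOfRankOne (NonFreeID.S C) (NonFreeID.M C) ∧
    ∃ D : NonFreeID.IterativeDerivation (NonFreeID.S C),
      NonFreeID.ExtendsPolyID C D ∧
      (∀ D' : NonFreeID.IterativeDerivation (NonFreeID.S C),
        NonFreeID.ExtendsPolyID C D' → D' = D) ∧
      NonFreeID.IsIDSimple D ∧
      ∀ b : NonFreeID.S C,
        ∃! DM : NonFreeID.ModuleIterativeDerivation D (NonFreeID.M C),
          DM.θ 1 (NonFreeID.f₁ C) = b • NonFreeID.f₁ C +
            ((3 * NonFreeID.s C ^ 2 + 1) * NonFreeID.dinv C) • NonFreeID.f₂ C ∧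
          DM.θ 1 (NonFreeID.f₂ C) = NonFreeID.s C • NonFreeID.f₁ C + b • NonFreeID.f₂ C := by
  open NonFreeID in
  refine ⟨isDedekindDomain_S C, ⟨equivI C, equivI_f₁ C, equivI_f₂ C⟩, not_isPrincipal_I C,
    isNonFreeProjectiveOfRankOne_of_invertible (not_free_I C),
    isNonFreeProjectiveOfRankOne_of_invertible (not_free_M C),
    .ofDerivation (derivT C), extendsPolyID_derivT C, unique_of_extendsPolyID C,
    isIDSimple_of_extendsPolyID C (extendsPolyID_derivT C), fun b => ?_⟩
  have hq := (relations C).mkQ_surjective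
  obtain ⟨D, hD, hD₁, hD₂⟩ := exists_connection_of_curve (derivT C) hq (dinv_spec C)
    (derivT_t C) (derivT_s C) (Submodule.ker_mkQ _) b
  let E := ModuleIterativeDerivation.ofConnection (derivT C) D hD
  have hE (m : M C) : E.θ 1 m = D m := ModuleIterativeDerivation.ofConnection_θ_one _ D hD m
  have hE₁ := (hE (f₁ C)).trans hD₁
  have hE₂ := (hE (f₂ C)).trans hD₂
  exact ⟨E, ⟨hE₁, hE₂⟩, fun D' h => ModuleIterativeDerivation.eq_of_generators C hq
    (h.1.trans hE₁.symm) (h.2.trans hE₂.symm)⟩
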